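/- Let $\mathcal F$ be a smooth foliation of codimension one on a compact smooth manifold $M$ without boundary (transverse orientability of $\mathcal F$ is not required). For a foliated chart $x=(x',x''):U\to\Sigma\times B''$ of $\mathcal F$, where $\Sigma\subset\mathbb R$ is an open interval, $B''\subset\mathbb R^{m}$ is an open ball and $\dim M=m+1$, the fibers of $x'$ are the plaques; the leaves are the path components of $M$ with the leaf topology, i.e. the topology generated by the open subsets of the plaques, and a leaf is called compact if it is compact in the leaf topology. Let $\phi=\{\phi^t\}_{t\in\mathbb R}$ be a smooth flow on $M$ that is foliated: every $\phi^t$ maps leaves to leaves. A leaf $L$ is preserved by $\phi$ if $\phi^t(L)=L$ for all $t$. For a foliated chart $(U,(x',x''))$ around a point $p$, let $\bar\phi$ be the local flow induced by $\phi$ on $\Sigma$ around $x'(p)$, so that $\bar\phi^t(x'(q))=x'(\phi^t(q))$ for $q$ near $p$ and $t$ near $0$. Assume that $\phi$ is transversely simple: for every preserved leaf $L$, every $p\in L$ and every foliated chart around $p$, the point $\bar p=x'(p)$ is a simple fixed point of $\bar\phi$; that is, $\bar\phi^t(\bar p)=\bar p$ and $(\bar\phi^t)_*=e^{\varkappa t}$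 on $T_{\bar p}\Sigma\equiv\mathbb R$ for all $t$ near $0$, for some real number $\varkappa\neq0$. Then: (1) the union $M^0$ of the leaves preserved by $\phi$ is a finite union of compact leaves; (2) $\mathcal F$ is almost without holonomy, i.e. every non-compact leaf has trivial (germinal) holonomy group; (3) only finitely many leaves of $\mathcal F$ have non-trivial holonomy group. -/

import Mathlib

open scoped Manifold ContDiff Topology

/-- Transverse coordinate `ℝ` times leafwise coordinates `ℝᵐ`. -/
abbrev FoliatedModel (m : ℕ) : Type := ℝ × EuclideanSpace ℝ (Fin m)

/-- A smooth codimension one foliation on a smooth `(m+1)`-manifold `M` without boundary, given by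
a foliated atlas. A chart `c` is written `(x', x'')`, with transverse coordinate
`x' = fun q => (c q).1`; its image is the product of an open interval and an open ball, and near
every point where two charts meet, the transverse coordinate of one of them is a function of the
transverse coordinate of the other one. (Smoothness of these functions of one variable
follows from the smoothness of the charts.) -/
structure Foliation (m : ℕ) (M : Type*) [TopologicalSpace M]
    [ChartedSpace (EuclideanSpace ℝ (Fin (m + 1))) M] where
  charts : Set (OpenPartialHomeomorph M (FoliatedModel m))
  smooth : ∀ c ∈ charts, ContMDiffOn (𝓡 (m + 1)) 𝓘(ℝ, FoliatedModel m) ∞ c c.source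
  smooth_symm : ∀ c ∈ charts,
    ContMDiffOn 𝓘(ℝ, FoliatedModel m) (𝓡 (m + 1)) ∞ c.symm c.target
  target_eq : ∀ c ∈ charts, ∃ (a : ℝ) (r : ℝ) (b : EuclideanSpace ℝ (Fin m)) (s : ℝ),
    0 < r ∧ 0 < s ∧ c.target = Metric.ball a r ×ˢ Metric.ball b s
  cover : ∀ p : M, ∃ c ∈ charts, p ∈ c.source
  compat : ∀ c ∈ charts, ∀ c' ∈ charts, ∀ p ∈ c.source ∩ c'.source,
    ∃ h : ℝ → ℝ, ∀ᶠ q in 𝓝 p, (c' q).1 = h (c q).1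

namespace Foliation

variable {m : ℕ} {M : Type*} [TopologicalSpace M]
  [ChartedSpace (EuclideanSpace ℝ (Fin (m + 1))) M]

/-- The plaque of the chart `c` at height `u`. -/
def plaque (c : OpenPartialHomeomorph M (FoliatedModel m)) (u : ℝ) : Set M :=
  {q | q ∈ c.source ∧ (c q).1 = u}

/-- The leaf topology, generated by the relatively open subsets of the plaques. It is finer than
the manifold topology. -/
@[reducible]
def leafTopology (F : Foliation m M) : TopologicalSpace M :=
  TopologicalSpace.generateFrom
    {s | ∃ c ∈ F.charts, ∃ (u : ℝ) (U : Set M), IsOpen U ∧ s = U ∩ plaque c u}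

/-- The leaf through `p`: its path component in the leaf topology. -/
def leaf (F : Foliation m M) (p : M) : Set M :=
  @pathComponent M F.leafTopology p

/-- The set of leaves. -/
def leaves (F : Foliation m M) : Set (Set M) :=
  Set.range F.leaf

/-- A subset (in practice a leaf) is compact as a subspace of `M` with the leaf topology. -/
def IsLeafwiseCompact (F : Foliation m M) (L : Set M) : Prop :=
  @IsCompact M F.leafTopology L

/-- `F.IsHolonomyAlong γ a b c c' h`: the local transformation `h` between transverse coordinates,
from that of the chart `c` at `γ a` to that of the chart `c'` at `γ b`, is a composition
`h_{k_m k_{m-1}} ∘ ⋯ ∘ h_{k_2 k_1}` of elementary holonomy transformations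
along a partition `a = t_0 ≤ ⋯ ≤ t_m = b` and charts `c = c_{k_1}, …, c_{k_m} = c'` such that
`γ [t_{i-1}, t_i]` is in the domain of `c_{k_i}`. Only the germ of `h` at the transverse
coordinate of `γ a` is meaningful. -/
inductive IsHolonomyAlong (F : Foliation m M) (γ : unitInterval → M) (a : unitInterval) :
    unitInterval → OpenPartialHomeomorph M (FoliatedModel m) →
      OpenPartialHomeomorph M (FoliatedModel m) → (ℝ → ℝ) → Prop
  | single {b : unitInterval} {c : OpenPartialHomeomorph M (FoliatedModel m)}
      (hc : c ∈ F.charts) (hab : a ≤ b) (hγ : ∀ s ∈ Set.Icc a b, γ s ∈ c.source) :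
      IsHolonomyAlong F γ a b c c id
  | step {b d : unitInterval} {c c' c'' : OpenPartialHomeomorph M (FoliatedModel m)}
      {h g : ℝ → ℝ} (hol : IsHolonomyAlong F γ a b c c' h)
      (hc : c'' ∈ F.charts) (hbd : b ≤ d) (hγ : ∀ s ∈ Set.Icc b d, γ s ∈ c''.source)
      (hg : ∀ᶠ q in 𝓝 (γ b), (c'' q).1 = g (c' q).1) :
      IsHolonomyAlong F γ a d c c'' (g ∘ h)

/-- The underlying set of the holonomy group, based at `p`, of the leaf through `p`,
realized with the foliated chart `c` around `p`: the germs at the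
transverse coordinate of `p` of the holonomies of the loops at `p` in the leaf. -/
def holonomyGroup (F : Foliation m M) (c : OpenPartialHomeomorph M (FoliatedModel m)) (p : M) :
    Set (Filter.Germ (𝓝 (c p).1) ℝ) :=
  {g | ∃ (γ : unitInterval → M) (h : ℝ → ℝ), Continuous[instTopologicalSpaceSubtype, F.leafTopology] γ ∧
    γ 0 = p ∧ γ 1 = p ∧ F.IsHolonomyAlong γ 0 1 c c h ∧ g = (h : Filter.Germ (𝓝 (c p).1) ℝ)}

/-- The leaf `L` has no holonomy: its holonomy group is trivial (at all base points and with all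
charts around them). -/
def HasNoHolonomy (F : Foliation m M) (L : Set M) : Prop :=
  ∀ p ∈ L, ∀ c ∈ F.charts, p ∈ c.source →
    F.holonomyGroup c p = {((id : ℝ → ℝ) : Filter.Germ (𝓝 (c p).1) ℝ)}

/-- All non-compact leaves have no holonomy. -/
def IsAlmostWithoutHolonomy (F : Foliation m M) : Prop :=
  ∀ L ∈ F.leaves, ¬ F.IsLeafwiseCompact L → F.HasNoHolonomy L

/-- The flow is smooth, and all of its transformations map leaves to leaves. -/
structure IsFoliatedFlow (F : Foliation m M) (φ : Flow ℝ M) : Prop where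
  smooth : ContMDiff (𝓘(ℝ, ℝ).prod (𝓡 (m + 1))) (𝓡 (m + 1)) ∞ (fun z : ℝ × M => φ z.1 z.2)
  mapsTo : ∀ (t : ℝ) (p : M), Set.MapsTo (φ t) (F.leaf p) (F.leaf (φ t p))

/-- The leaves preserved by the flow. -/
def preservedLeaves (F : Foliation m M) (φ : Flow ℝ M) : Set (Set M) :=
  {L | L ∈ F.leaves ∧ ∀ t : ℝ, φ t '' L = L}

/-- The union `M⁰` of the leaves preserved by the flow. -/
def preservedSet (F : Foliation m M) (φ : Flow ℝ M) : Set M :=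
  ⋃₀ F.preservedLeaves φ

/-- The local flow induced by `φ` on the transverse coordinate of the foliated chart
`c = (x', x'')` around `p`. For `t` near `0` and `u` near `x' p`, it satisfies
`inducedFlow φ c p t (x' q) = x' (φ t q)` for `q` near `p` if `φ` is foliated. It is computed
here on the local transversal `x'' = x'' p` through `p`. -/
noncomputable def inducedFlow (φ : Flow ℝ M) (c : OpenPartialHomeomorph M (FoliatedModel m))
    (p : M) (t u : ℝ) : ℝ :=
  (c (φ t (c.symm (u, (c p).2)))).1

end Foliation

/-- The point `u₀` is a simple fixed point of the local flow `ψ` on (an open subset of) `ℝ`: it is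
fixed, and the tangent map of `ψ t` at `u₀` is `exp (κ t)` with `κ ≠ 0`, for all `t` near `0`. -/
def IsSimpleFixedPoint (ψ : ℝ → ℝ → ℝ) (u₀ : ℝ) : Prop :=
  (∀ᶠ t in 𝓝 (0 : ℝ), ψ t u₀ = u₀) ∧
    ∃ κ : ℝ, κ ≠ 0 ∧ ∀ᶠ t in 𝓝 (0 : ℝ), HasDerivAt (ψ t) (Real.exp (κ * t)) u₀

namespace Foliation

variable {m : ℕ} {M : Type*} [TopologicalSpace M]
  [ChartedSpace (EuclideanSpace ℝ (Fin (m + 1))) M]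

/-- All points corresponding to the leaf `L` in the transverse coordinates of
foliated charts are simple fixed points of the induced local flow. -/
def IsTransverselySimpleLeaf (F : Foliation m M) (φ : Flow ℝ M) (L : Set M) : Prop :=
  ∀ p ∈ L, ∀ c ∈ F.charts, p ∈ c.source → IsSimpleFixedPoint (inducedFlow φ c p) (c p).1

/-- A foliated flow all of whose preserved leaves are transversely simple. -/
structure IsTransverselySimpleFlow (F : Foliation m M) (φ : Flow ℝ M) : Prop
    extends F.IsFoliatedFlow φ where
  simple : ∀ L ∈ F.preservedLeaves φ, F.IsTransverselySimpleLeaf φ L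

end Foliation

/-! Let Z be `tangencySet`, the set of points where the velocity of the flow is tangent to the
leaves. The proof shows that M⁰ = Z (`preservedSet_eq`). In Z the transverse coordinate has zero
derivative along orbits, so orbits stay in their leaves and these leaves are preserved. Conversely,
a preserved leaf gives fixed points of the induced flow, where the transverse speed vanishes.

If p ∈ Z, then for small t ≠ 0 the derivative of `inducedFlow` minus the identity at x'(p) is e^{ϰt}
- 1 ≠ 0, so x'(p) is an isolated fixed point and Z lies in a single plaque near p
(`eventually_transverse_eq`). Hence the manifold and leaf topologies agree on Z. Being closed in M,
Z is compact in the leaf topology. Leaves are open and closed in that topology, so Z is a finite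
union of compact leaves.

On a leaf disjoint from Z the flow is transverse. The holonomy h of a loop at p commutes with the
flow, so h fixes x'(φ^t p) for t near 0. These values fill a neighborhood of x'(p), so h is the
identity germ (`hasNoHolonomy_of_not_tangent`). Only the leaves in Z can therefore have holonomy.

All this requires plaques to be locally mapped into plaques, whereas φ is only assumed to map leaves
to leaves. `exists_nhds_transverse_eq` bridges the gap, because a leaf meets a chart at countably
many heights. -/

namespace Foliation

open Set Filter

variable {m : ℕ} {M : Type*} [TopologicalSpace M]

/-- The plaques, of charts in `T`, that are reached by chains of at most `n` consecutively
intersecting plaques from a plaque through `p`. -/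
def reachablePlaques (T : Set (OpenPartialHomeomorph M (FoliatedModel m))) (p : M) :
    ℕ → Set (OpenPartialHomeomorph M (FoliatedModel m) × ℝ)
  | 0 => {k | k.1 ∈ T ∧ p ∈ plaque k.1 k.2}
  | n + 1 => {k | k.1 ∈ T ∧
      ∃ l ∈ reachablePlaques T p n, (plaque l.1 l.2 ∩ plaque k.1 k.2).Nonempty}

theorem reachablePlaques_fst_mem {T : Set (OpenPartialHomeomorph M (FoliatedModel m))} {p : M}
    {n : ℕ} {k : OpenPartialHomeomorph M (FoliatedModel m) × ℝ}
    (hk : k ∈ reachablePlaques T p n) : k.1 ∈ T := by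
  cases n <;> exact hk.1

variable [ChartedSpace (EuclideanSpace ℝ (Fin (m + 1))) M]

/-! ### The leaf topology -/

theorem isOpen_leafTopology_plaque (F : Foliation m M)
    {c : OpenPartialHomeomorph M (FoliatedModel m)} (hc : c ∈ F.charts) (u : ℝ) :
    IsOpen[F.leafTopology] (plaque c u) :=
  TopologicalSpace.isOpen_generateFrom_of_mem ⟨c, hc, u, univ, isOpen_univ, by simp⟩

theorem leafTopology_le (F : Foliation m M) : F.leafTopology ≤ ‹TopologicalSpace M› := by
  intro U hU
  rw [@isOpen_iff_mem_nhds M F.leafTopology]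
  intro p hp
  obtain ⟨c, hc, hpc⟩ := F.cover p
  have h : IsOpen[F.leafTopology] (U ∩ plaque c (c p).1) :=
    TopologicalSpace.isOpen_generateFrom_of_mem ⟨c, hc, (c p).1, U, hU, rfl⟩
  exact mem_of_superset (@IsOpen.mem_nhds M F.leafTopology _ _ h ⟨hp, hpc, rfl⟩) inter_subset_left

/-- One chart suffices to test leafwise convergence: by `compat`, the height in any other chart is
locally a function of the height in `c`. -/
theorem tendsto_nhds_leafTopology (F : Foliation m M) {α : Type*} {f : α → M} {l : Filter α}
    {p : M} (hf : Tendsto f l (𝓝 p)) {c : OpenPartialHomeomorph M (FoliatedModel m)}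
    (hc : c ∈ F.charts) (hp : p ∈ c.source) (h : ∀ᶠ x in l, (c (f x)).1 = (c p).1) :
    Tendsto f l (@nhds M F.leafTopology p) := by
  rw [TopologicalSpace.nhds_generateFrom]
  simp only [tendsto_iInf, tendsto_principal]
  rintro s ⟨hps, c', hc', u, U, hU, rfl⟩
  obtain ⟨g, hg⟩ := F.compat c hc c' hc' p ⟨hp, hps.2.1⟩
  filter_upwards [h, hf (hU.mem_nhds hps.1), hf (c'.open_source.mem_nhds hps.2.1),
    hf.eventually hg] with x hx hxU hxs hxg
  refine ⟨hxU, hxs, ?_⟩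
  rw [hxg, hx, ← hg.self_of_nhds, hps.2.2]

theorem plaque_mem_nhds_leafTopology (F : Foliation m M)
    {c : OpenPartialHomeomorph M (FoliatedModel m)} (hc : c ∈ F.charts) {p : M}
    (hp : p ∈ c.source) : plaque c (c p).1 ∈ @nhds M F.leafTopology p :=
  @IsOpen.mem_nhds M F.leafTopology _ _ (F.isOpen_leafTopology_plaque hc _) ⟨hp, rfl⟩

/-! ### Plaques and leaves -/

theorem mem_leaf_self (F : Foliation m M) (p : M) : p ∈ F.leaf p :=
  @mem_pathComponent_self M F.leafTopology p

theorem leaf_eq_of_mem (F : Foliation m M) {p q : M} (h : q ∈ F.leaf p) : F.leaf q = F.leaf p :=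
  @pathComponent_congr M F.leafTopology q p h

theorem plaque_subset_leaf (F : Foliation m M)
    {c : OpenPartialHomeomorph M (FoliatedModel m)} (hc : c ∈ F.charts) {p q : M}
    (hp : p ∈ c.source) (hq : q ∈ c.source) (h : (c p).1 = (c q).1) : q ∈ F.leaf p := by
  obtain ⟨a, r, b, s, -, -, htgt⟩ := F.target_eq c hc
  have hpt : c p ∈ Metric.ball a r ×ˢ Metric.ball b s := htgt ▸ c.map_source hp
  have hqt : c q ∈ Metric.ball a r ×ˢ Metric.ball b s := htgt ▸ c.map_source hq
  have key : @ContinuousOn _ _ _ F.leafTopology (fun y => c.symm ((c p).1, y)) (Metric.ball b s) := by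
    intro y hy
    have hz : ((c p).1, y) ∈ c.target := htgt ▸ ⟨hpt.1, hy⟩
    refine F.tendsto_nhds_leafTopology ?_ hc (c.map_target hz) ?_
    · have h1 : ContinuousAt c.symm ((c p).1, y) := c.continuousAt_symm hz
      exact (h1.comp (f := fun y => ((c p).1, y)) (by fun_prop)).tendsto.mono_left inf_le_left
    · filter_upwards [self_mem_nhdsWithin] with y' hy'
      have hz' : ((c p).1, y') ∈ c.target := htgt ▸ ⟨hpt.1, hy'⟩
      rw [c.right_inv hz, c.right_inv hz']
  have hball : IsPathConnected (Metric.ball b s) :=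
    (convex_ball b s).isPathConnected ⟨_, hpt.2⟩
  have hp' : c.symm ((c p).1, (c p).2) = p := c.left_inv hp
  have hq' : c.symm ((c p).1, (c q).2) = q := by rw [h]; exact c.left_inv hq
  have himg := @IsPathConnected.image' _ M _ F.leafTopology _ hball _ key
  have hj := @IsPathConnected.joinedIn M F.leafTopology _ himg p ⟨_, hpt.2, hp'⟩ q ⟨_, hqt.2, hq'⟩
  exact @JoinedIn.joined M F.leafTopology _ _ _ hj

theorem isOpen_leafTopology_leaf (F : Foliation m M) (p : M) :
    IsOpen[F.leafTopology] (F.leaf p) := by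
  rw [@isOpen_iff_mem_nhds M F.leafTopology]
  intro q hq
  obtain ⟨c, hc, hqc⟩ := F.cover q
  refine mem_of_superset (F.plaque_mem_nhds_leafTopology hc hqc) fun x hx => ?_
  rw [← F.leaf_eq_of_mem hq]
  exact F.plaque_subset_leaf hc hqc hx.1 hx.2.symm

theorem isClosed_leafTopology_leaf (F : Foliation m M) (p : M) :
    IsClosed[F.leafTopology] (F.leaf p) := by
  rw [← @isOpen_compl_iff M _ F.leafTopology, @isOpen_iff_mem_nhds M F.leafTopology]
  intro q hq
  refine mem_of_superset (@IsOpen.mem_nhds M F.leafTopology _ _ (F.isOpen_leafTopology_leaf q)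
    (F.mem_leaf_self q)) fun x hx hxp => hq ?_
  rw [← F.leaf_eq_of_mem hxp, F.leaf_eq_of_mem hx]
  exact F.mem_leaf_self q

/-! ### A leaf meets a chart in countably many plaques -/

/-- The height in `c'` is locally constant on a plaque of `c`, and subsets of M are Lindelöf. -/
theorem countable_heights_plaque [SecondCountableTopology M] (F : Foliation m M)
    {c c' : OpenPartialHomeomorph M (FoliatedModel m)} (hc : c ∈ F.charts) (hc' : c' ∈ F.charts)
    (u : ℝ) : ((fun q => (c' q).1) '' (plaque c u ∩ c'.source)).Countable := by
  set S := plaque c u ∩ c'.source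
  obtain ⟨t, hts, htc, hcov⟩ := TopologicalSpace.countable_cover_nhdsWithin
    (f := fun p => {q | (c' q).1 = (c' p).1}) (s := S) fun p hp => by
      obtain ⟨g, hg⟩ := F.compat c hc c' hc' p ⟨hp.1.1, hp.2⟩
      filter_upwards [self_mem_nhdsWithin, mem_nhdsWithin_of_mem_nhds hg] with q hqS hq
      rw [hq, hqS.1.2, ← hp.1.2, ← hg.self_of_nhds]
  refine (htc.image fun q => (c' q).1).mono ?_
  rintro _ ⟨q, hq, rfl⟩
  obtain ⟨p, hp, hqp⟩ := mem_iUnion₂.1 (hcov hq)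
  exact ⟨p, hp, hqp.symm⟩

theorem countable_reachablePlaques [SecondCountableTopology M] (F : Foliation m M)
    {T : Set (OpenPartialHomeomorph M (FoliatedModel m))} (hT : T.Countable) (hTF : T ⊆ F.charts)
    (p : M) (n : ℕ) : (reachablePlaques T p n).Countable := by
  induction n with
  | zero =>
    refine (hT.image fun c => (c, (c p).1)).mono ?_
    rintro ⟨c, u⟩ ⟨hc, hu⟩
    exact ⟨c, hc, Prod.ext rfl hu.2⟩
  | succ n ih =>
    have h : (⋃ l ∈ reachablePlaques T p n, ⋃ c ∈ T,
        (fun u => (c, u)) '' ((fun q => (c q).1) '' (plaque l.1 l.2 ∩ c.source))).Countable :=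
      ih.biUnion fun l hl => hT.biUnion fun c hc =>
        (F.countable_heights_plaque (hTF (reachablePlaques_fst_mem hl)) (hTF hc) l.2).image _
    refine h.mono ?_
    rintro ⟨c, u⟩ ⟨hc, l, hl, q, hql, hq⟩
    exact mem_iUnion₂.2 ⟨l, hl, mem_iUnion₂.2 ⟨c, hc, u, ⟨q, ⟨hql, hq.1⟩, hq.2⟩, rfl⟩⟩

/-- Take countably many charts covering M. The union of the plaques reached from p by finite chains
is clopen in the leaf topology, since a plaque meeting a reached one is reached one step later. It
thus contains the leaf, and only countably many plaques are reached. -/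
theorem countable_heights_leaf [SecondCountableTopology M] (F : Foliation m M) (p : M)
    {c : OpenPartialHomeomorph M (FoliatedModel m)} (hc : c ∈ F.charts) :
    ((fun q => (c q).1) '' (F.leaf p ∩ c.source)).Countable := by
  choose C hC hmem using F.cover
  obtain ⟨s, hs, hcov⟩ := TopologicalSpace.countable_cover_nhds
    (f := fun q => (C q).source) fun q => (C q).open_source.mem_nhds (hmem q)
  set T := C '' s
  have hT : T.Countable := hs.image C
  have hTF : T ⊆ F.charts := by rintro _ ⟨q, -, rfl⟩; exact hC q
  have hTcov : ∀ q, ∃ d ∈ T, q ∈ d.source := fun q => by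
    obtain ⟨x, hx, hq⟩ := mem_iUnion₂.1 (hcov.symm ▸ mem_univ q : q ∈ ⋃ x ∈ s, (C x).source)
    exact ⟨C x, ⟨x, hx, rfl⟩, hq⟩
  set R := ⋃ n, reachablePlaques T p n
  have hR : R.Countable := countable_iUnion (F.countable_reachablePlaques hT hTF p)
  have hRF : ∀ k ∈ R, k.1 ∈ F.charts := fun k hk => by
    obtain ⟨n, hn⟩ := mem_iUnion.1 hk
    exact hTF (reachablePlaques_fst_mem hn)
  have hclopen : @IsClopen M F.leafTopology (⋃ k ∈ R, plaque k.1 k.2) := by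
    constructor
    · rw [← @isOpen_compl_iff M _ F.leafTopology, @isOpen_iff_mem_nhds M F.leafTopology]
      intro q hq
      obtain ⟨d, hd, hqd⟩ := hTcov q
      refine mem_of_superset (F.plaque_mem_nhds_leafTopology (hTF hd) hqd) fun x hx hxR => hq ?_
      obtain ⟨k, hk, hxk⟩ := mem_iUnion₂.1 hxR
      obtain ⟨n, hn⟩ := mem_iUnion.1 hk
      exact mem_iUnion₂.2 ⟨(d, (d q).1), mem_iUnion.2 ⟨n + 1, hd, k, hn, x, hxk, hx⟩, hqd, rfl⟩
    · exact @isOpen_biUnion _ _ F.leafTopology _ _ fun k hk => F.isOpen_leafTopology_plaque (hRF k hk) k.2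
  have hpR : p ∈ ⋃ k ∈ R, plaque k.1 k.2 := by
    obtain ⟨d, hd, hpd⟩ := hTcov p
    exact mem_iUnion₂.2 ⟨(d, (d p).1), mem_iUnion.2 ⟨0, hd, hpd, rfl⟩, hpd, rfl⟩
  have hsub : F.leaf p ⊆ ⋃ k ∈ R, plaque k.1 k.2 :=
    (@pathComponent_subset_component M F.leafTopology p).trans
      (@IsClopen.connectedComponent_subset M F.leafTopology _ _ hclopen hpR)
  refine (hR.biUnion fun k hk => F.countable_heights_plaque (hRF k hk) hc k.2).mono ?_
  rintro _ ⟨q, ⟨hq, hqc⟩, rfl⟩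
  obtain ⟨k, hk, hqk⟩ := mem_iUnion₂.1 (hsub hq)
  exact mem_iUnion₂.2 ⟨k, hk, q, ⟨hqk, hqc⟩, rfl⟩

end Foliation

namespace Foliation

open Set Filter

variable {m : ℕ} {M : Type*} [TopologicalSpace M]
  [ChartedSpace (EuclideanSpace ℝ (Fin (m + 1))) M]

/-! ### Foliated flows in transverse coordinates -/

/-- A foliated flow locally maps plaques into plaques. -/
theorem IsFoliatedFlow.exists_nhds_transverse_eq [SecondCountableTopology M] {F : Foliation m M}
    {φ : Flow ℝ M} (hφ : F.IsFoliatedFlow φ) {c c' : OpenPartialHomeomorph M (FoliatedModel m)}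
    (hc : c ∈ F.charts) (hc' : c' ∈ F.charts) {t₀ : ℝ} {p : M} (hp : p ∈ c.source)
    (hp' : φ t₀ p ∈ c'.source) :
    ∃ W ∈ 𝓝 t₀, ∃ V ∈ 𝓝 p, V ⊆ c.source ∧ ∀ t ∈ W, ∀ q ∈ V, φ t q ∈ c'.source ∧
      ∀ q' ∈ V, (c q).1 = (c q').1 → (c' (φ t q)).1 = (c' (φ t q')).1 := by
  have hcont : ContinuousAt (fun w : ℝ × FoliatedModel m => φ w.1 (c.symm w.2)) (t₀, c p) := by
    have h1 : ContinuousAt c.symm (c p) := c.continuousAt_symm (c.map_source hp)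
    have h2 : ContinuousAt (fun w : ℝ × FoliatedModel m => c.symm w.2) (t₀, c p) :=
      ContinuousAt.comp (f := fun w : ℝ × FoliatedModel m => w.2) h1 continuousAt_snd
    exact φ.cont'.continuousAt.comp (continuousAt_fst.prodMk h2)
  have hev : ∀ᶠ w in 𝓝 (t₀, c p), φ w.1 (c.symm w.2) ∈ c'.source ∧ w.2 ∈ c.target :=
    (hcont.eventually (c'.open_source.mem_nhds (by simpa [c.left_inv hp] using hp'))).and
      (continuousAt_snd.eventually (c.open_target.mem_nhds (c.map_source hp)))
  rw [nhds_prod_eq] at hev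
  obtain ⟨W, hW, B, hB, hWB⟩ := mem_prod_iff.1 hev
  obtain ⟨ε, hε, hεB⟩ := Metric.mem_nhds_iff.1 hB
  refine ⟨W, hW, c.source ∩ c ⁻¹' Metric.ball (c p) ε,
    inter_mem (c.open_source.mem_nhds hp)
      (c.continuousAt hp (Metric.ball_mem_nhds _ hε)), inter_subset_left, ?_⟩
  rintro t ht q ⟨hq, hqε⟩
  refine ⟨by simpa [c.left_inv hq] using (hWB (mk_mem_prod ht (hεB hqε))).1, ?_⟩
  rintro q' ⟨hq', hqε'⟩ heq
  rw [mem_preimage, ← ball_prod_same] at hqε hqε'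
  set D := Metric.ball (c p).2 ε
  have hmem : ∀ y ∈ D, φ t (c.symm ((c q).1, y)) ∈ c'.source ∧ ((c q).1, y) ∈ c.target :=
    fun y hy => hWB (mk_mem_prod ht (hεB (by rw [← ball_prod_same]; exact ⟨hqε.1, hy⟩)))
  have hk : ContinuousOn (fun y => (c' (φ t (c.symm ((c q).1, y)))).1) D := by
    intro y hy
    refine ContinuousAt.continuousWithinAt ?_
    have h1 : ContinuousAt (fun y => c.symm ((c q).1, y)) y :=
      ContinuousAt.comp (f := fun y => ((c q).1, y)) (c.continuousAt_symm (hmem y hy).2)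
        (by fun_prop)
    have h2 : ContinuousAt (fun y => φ t (c.symm ((c q).1, y))) y :=
      ContinuousAt.comp (f := fun y => c.symm ((c q).1, y))
        (φ.continuous_toFun t).continuousAt h1
    exact continuousAt_fst.comp (ContinuousAt.comp (f := fun y => φ t (c.symm ((c q).1, y)))
      (c'.continuousAt (hmem y hy).1) h2)
  -- The image of a plaque stays in one leaf, so its heights form a countable set. They also form a
  -- connected set, hence a single point.
  have hsub : (fun y => (c' (φ t (c.symm ((c q).1, y)))).1) '' D ⊆
      (fun x => (c' x).1) '' (F.leaf (φ t q) ∩ c'.source) := by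
    rintro _ ⟨y, hy, rfl⟩
    refine ⟨_, ⟨hφ.mapsTo t q ?_, (hmem y hy).1⟩, rfl⟩
    refine F.plaque_subset_leaf hc hq (c.map_target (hmem y hy).2) ?_
    rw [c.right_inv (hmem y hy).2]
  have hss := (F.countable_heights_leaf (φ t q) hc').isTotallyDisconnected _ hsub
    ((convex_ball (c p).2 ε).isPreconnected.image _ hk)
  have e : c.symm ((c q).1, (c q).2) = q := c.left_inv hq
  have e' : c.symm ((c q).1, (c q').2) = q' := by rw [heq]; exact c.left_inv hq'
  have := hss ⟨_, hqε.2, rfl⟩ ⟨_, hqε'.2, rfl⟩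
  simpa only [e, e'] using this

/-- The transverse coordinate of a smooth flow, as a function of time and of the coordinates of
the initial point. -/
theorem IsFoliatedFlow.contDiffAt_transverse {F : Foliation m M} {φ : Flow ℝ M}
    (hφ : F.IsFoliatedFlow φ) {c c' : OpenPartialHomeomorph M (FoliatedModel m)}
    (hc : c ∈ F.charts) (hc' : c' ∈ F.charts) {t₀ : ℝ} {p : M} (hp : p ∈ c.source)
    (hp' : φ t₀ p ∈ c'.source) :
    ContDiffAt ℝ ∞ (fun w : ℝ × FoliatedModel m => (c' (φ w.1 (c.symm w.2))).1) (t₀, c p) := by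
  have hinv := c.left_inv hp
  have h1 : ContMDiffAt 𝓘(ℝ, FoliatedModel m) (𝓡 (m + 1)) ∞ c.symm (c p) :=
    (F.smooth_symm c hc).contMDiffAt (c.open_target.mem_nhds (c.map_source hp))
  have h2 : ContMDiffAt 𝓘(ℝ, ℝ × FoliatedModel m) (𝓡 (m + 1)) ∞
      (fun w : ℝ × FoliatedModel m => c.symm w.2) (t₀, c p) :=
    ContMDiffAt.comp (g := c.symm) (t₀, c p) h1 contDiffAt_snd.contMDiffAt
  have h3 : ContMDiffAt 𝓘(ℝ, ℝ × FoliatedModel m) (𝓘(ℝ, ℝ).prod (𝓡 (m + 1))) ∞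
      (fun w : ℝ × FoliatedModel m => (w.1, c.symm w.2)) (t₀, c p) :=
    ContMDiffAt.prodMk (f := Prod.fst) contDiffAt_fst.contMDiffAt h2
  have h4 : ContMDiffAt 𝓘(ℝ, ℝ × FoliatedModel m) (𝓡 (m + 1)) ∞
      (fun w : ℝ × FoliatedModel m => φ w.1 (c.symm w.2)) (t₀, c p) :=
    ContMDiffAt.comp (t₀, c p) (hφ.smooth _) h3
  have h5 : ContMDiffAt (𝓡 (m + 1)) 𝓘(ℝ, FoliatedModel m) ∞ c' (φ t₀ (c.symm (c p))) :=
    (F.smooth c' hc').contMDiffAt (c'.open_source.mem_nhds (by rwa [hinv]))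
  have h6 : ContMDiffAt 𝓘(ℝ, ℝ × FoliatedModel m) 𝓘(ℝ, FoliatedModel m) ∞
      (fun w : ℝ × FoliatedModel m => c' (φ w.1 (c.symm w.2))) (t₀, c p) :=
    ContMDiffAt.comp (g := c') (f := fun w : ℝ × FoliatedModel m => φ w.1 (c.symm w.2))
      (t₀, c p) h5 h4
  exact h6.contDiffAt.fst

theorem IsFoliatedFlow.contDiffAt_transverse_orbit {F : Foliation m M} {φ : Flow ℝ M}
    (hφ : F.IsFoliatedFlow φ) {c : OpenPartialHomeomorph M (FoliatedModel m)}
    (hc : c ∈ F.charts) {t₀ : ℝ} {p : M} (hp : φ t₀ p ∈ c.source) :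
    ContDiffAt ℝ ∞ (fun t => c (φ t p)) t₀ := by
  have h4 : ContMDiffAt 𝓘(ℝ, ℝ) (𝓡 (m + 1)) ∞ (fun t => φ t p) t₀ :=
    ContMDiffAt.comp (g := fun z : ℝ × M => φ z.1 z.2) (f := fun t => (t, p)) t₀ (hφ.smooth _)
      (contMDiffAt_id.prodMk contMDiffAt_const)
  have h5 : ContMDiffAt (𝓡 (m + 1)) 𝓘(ℝ, FoliatedModel m) ∞ c (φ t₀ p) :=
    (F.smooth c hc).contMDiffAt (c.open_source.mem_nhds hp)
  exact (ContMDiffAt.comp (g := c) t₀ h5 h4).contDiffAt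

end Foliation

/-! ### Tangency of the flow to the leaves -/

namespace Foliation

open Set Filter

variable {m : ℕ} {M : Type*} [TopologicalSpace M]

/-- The transverse component, in the chart `c`, of the velocity of the flow at `p`. -/
noncomputable def transverseSpeed (φ : Flow ℝ M) (c : OpenPartialHomeomorph M (FoliatedModel m))
    (p : M) : ℝ :=
  deriv (fun t => (c (φ t p)).1) 0

theorem continuous_orbit (φ : Flow ℝ M) (p : M) : Continuous fun t => φ t p :=
  φ.cont'.comp (continuous_id.prodMk continuous_const)

theorem tendsto_orbit_zero (φ : Flow ℝ M) (p : M) : Tendsto (fun t => φ t p) (𝓝 0) (𝓝 p) := by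
  simpa using (continuous_orbit φ p).tendsto 0

theorem tendsto_project_transversal {c : OpenPartialHomeomorph M (FoliatedModel m)} {p : M}
    (hp : p ∈ c.source) : Tendsto (fun q => c.symm ((c q).1, (c p).2)) (𝓝 p) (𝓝 p) := by
  have h1 : ContinuousAt (fun q => ((c q).1, (c p).2)) p :=
    (continuousAt_fst.comp (c.continuousAt hp)).prodMk continuousAt_const
  have h2 : ContinuousAt (fun q => c.symm ((c q).1, (c p).2)) p :=
    ContinuousAt.comp (f := fun q => ((c q).1, (c p).2))
      (c.continuousAt_symm (c.map_source hp)) h1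
  have h3 : c.symm ((c p).1, (c p).2) = p := c.left_inv hp
  simpa only [ContinuousAt, h3] using h2

theorem eventually_project_transversal {c : OpenPartialHomeomorph M (FoliatedModel m)} {p : M}
    (hp : p ∈ c.source) : ∀ᶠ q in 𝓝 p, c (c.symm ((c q).1, (c p).2)) = ((c q).1, (c p).2) := by
  have h1 : ContinuousAt (fun q => ((c q).1, (c p).2)) p :=
    (continuousAt_fst.comp (c.continuousAt hp)).prodMk continuousAt_const
  filter_upwards [h1 (c.open_target.mem_nhds (c.map_source hp))] with q hq
  exact c.right_inv hq

variable [ChartedSpace (EuclideanSpace ℝ (Fin (m + 1))) M]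

/-- The points where the velocity of the flow is tangent to the leaves. -/
def tangencySet (F : Foliation m M) (φ : Flow ℝ M) : Set M :=
  {p | ∀ c ∈ F.charts, p ∈ c.source → transverseSpeed φ c p = 0}

namespace IsFoliatedFlow

variable {F : Foliation m M} {φ : Flow ℝ M} {c c' : OpenPartialHomeomorph M (FoliatedModel m)}

theorem hasDerivAt_transverse_orbit (hφ : F.IsFoliatedFlow φ) (hc : c ∈ F.charts) {s : ℝ} {p : M}
    (hp : φ s p ∈ c.source) :
    HasDerivAt (fun t => (c (φ t p)).1) (transverseSpeed φ c (φ s p)) s := by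
  have h0 : ContDiffAt ℝ ∞ (fun t => c (φ t (φ s p))) (s - s) := by
    rw [sub_self]
    exact hφ.contDiffAt_transverse_orbit hc (by rwa [φ.map_zero_apply])
  have h1 := (h0.fst.differentiableAt (by simp)).hasDerivAt.comp_sub_const s s
  simpa only [← φ.map_add, sub_add_cancel, sub_self, transverseSpeed] using h1

/-- The height of φ^s(q) depends only on the height of q near p, so the orbit of p may be replaced
by its projection to the transversal x'' = x''(p), which has zero velocity. The chain rule
concludes. The case s = 0 gives independence of the chart. -/
theorem transverseSpeed_eq_zero_of_flow [SecondCountableTopology M] (hφ : F.IsFoliatedFlow φ)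
    (hc : c ∈ F.charts) (hc' : c' ∈ F.charts) {s : ℝ} {p : M} (hp : p ∈ c.source)
    (hp' : φ s p ∈ c'.source) (h : transverseSpeed φ c p = 0) :
    transverseSpeed φ c' (φ s p) = 0 := by
  obtain ⟨W, hW, V, hV, -, hWV⟩ := hφ.exists_nhds_transverse_eq hc hc' hp hp'
  have hG : DifferentiableAt ℝ (fun z : FoliatedModel m => (c' (φ s (c.symm z))).1) (c p) := by
    have := (hφ.contDiffAt_transverse hc hc' hp hp').differentiableAt (by simp)
    exact this.comp (f := fun z : FoliatedModel m => (s, z)) (c p) (by fun_prop)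
  have hw : HasDerivAt (fun t => ((c (φ t p)).1, (c p).2))
      ((0 : ℝ), (0 : EuclideanSpace ℝ (Fin m))) 0 := by
    have := hφ.hasDerivAt_transverse_orbit hc (s := 0) (p := p) (by rwa [φ.map_zero_apply])
    rw [φ.map_zero_apply, h] at this
    exact this.prodMk (hasDerivAt_const _ _)
  have hφ0 := tendsto_orbit_zero φ p
  have hG' : HasFDerivAt (fun z : FoliatedModel m => (c' (φ s (c.symm z))).1)
      (fderiv ℝ (fun z : FoliatedModel m => (c' (φ s (c.symm z))).1) (c p))
      ((c (φ 0 p)).1, (c p).2) := by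
    rw [φ.map_zero_apply]; exact hG.hasFDerivAt
  have hder := hG'.comp_hasDerivAt (0 : ℝ) hw
  have hzero : ((0 : ℝ), (0 : EuclideanSpace ℝ (Fin m))) = 0 := rfl
  rw [hzero, map_zero] at hder
  refine (hder.congr_of_eventuallyEq ?_).deriv
  filter_upwards [hφ0 hV, hφ0 ((tendsto_project_transversal hp) hV),
    hφ0.eventually (eventually_project_transversal hp)] with t h1 h2 h3
  have := ((hWV s (mem_of_mem_nhds hW) _ h1).2 _ h2 (by rw [h3]))
  rw [← φ.map_add, add_comm, φ.map_add, this]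
  rfl

theorem mem_tangencySet [SecondCountableTopology M] (hφ : F.IsFoliatedFlow φ)
    (hc : c ∈ F.charts) {p : M} (hp : p ∈ c.source) :
    p ∈ F.tangencySet φ ↔ transverseSpeed φ c p = 0 := by
  refine ⟨fun h => h c hc hp, fun h c' hc' hp' => ?_⟩
  have := hφ.transverseSpeed_eq_zero_of_flow hc hc' (s := 0) hp (by rwa [φ.map_zero_apply]) h
  rwa [φ.map_zero_apply] at this

theorem flow_mem_tangencySet [SecondCountableTopology M] (hφ : F.IsFoliatedFlow φ)
    {p : M} (hp : p ∈ F.tangencySet φ) (s : ℝ) : φ s p ∈ F.tangencySet φ := by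
  intro c' hc' hp'
  obtain ⟨c, hc, hpc⟩ := F.cover p
  exact hφ.transverseSpeed_eq_zero_of_flow hc hc' hpc hp' (hp c hc hpc)

theorem continuousAt_transverseSpeed (hφ : F.IsFoliatedFlow φ) (hc : c ∈ F.charts) {p : M}
    (hp : p ∈ c.source) : ContinuousAt (transverseSpeed φ c) p := by
  set G := fun w : ℝ × FoliatedModel m => (c (φ w.1 (c.symm w.2))).1
  have hG : ∀ q ∈ c.source, ContDiffAt ℝ ∞ G (0, c q) := fun q hq =>
    hφ.contDiffAt_transverse hc hc hq (by rwa [φ.map_zero_apply])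
  have h1 : ContinuousAt (fun q => fderiv ℝ G (0, c q) (1, 0)) p := by
    have h2 : ContinuousAt (fderiv ℝ G) (0, c p) :=
      (hG p hp).continuousAt_fderiv (by simp)
    have h3 : ContinuousAt (fun q => fderiv ℝ G (0, c q)) p :=
      ContinuousAt.comp (f := fun q => ((0 : ℝ), c q)) h2
        (continuousAt_const.prodMk (c.continuousAt hp))
    exact h3.clm_apply continuousAt_const
  refine h1.congr ?_
  filter_upwards [c.open_source.mem_nhds hp] with q hq
  have h4 : HasDerivAt (fun t : ℝ => (t, c q)) ((1 : ℝ), (0 : FoliatedModel m)) 0 :=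
    (hasDerivAt_id _).prodMk (hasDerivAt_const _ _)
  have h5 := ((hG q hq).differentiableAt (by simp)).hasFDerivAt.comp_hasDerivAt (0 : ℝ) h4
  have h6 : (G ∘ fun t : ℝ => (t, c q)) = fun t => (c (φ t q)).1 := by
    funext t
    simp only [G, Function.comp, c.left_inv hq]
  rw [h6] at h5
  exact h5.deriv.symm

theorem isClosed_tangencySet (hφ : F.IsFoliatedFlow φ) : IsClosed (F.tangencySet φ) := by
  rw [← isOpen_compl_iff, isOpen_iff_mem_nhds]
  intro p hp
  simp only [tangencySet, mem_compl_iff, mem_ofPred_eq, not_forall] at hp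
  obtain ⟨c, hc, hpc, hne⟩ := hp
  filter_upwards [(hφ.continuousAt_transverseSpeed hc hpc).eventually_ne hne,
    c.open_source.mem_nhds hpc] with q hq hqc hqZ
  exact hq (hqZ c hc hqc)

/-- The transverse coordinate is constant along orbits in the tangency set. -/
theorem transverse_orbit_eq [SecondCountableTopology M] (hφ : F.IsFoliatedFlow φ)
    (hc : c ∈ F.charts) {p : M} (hp : p ∈ F.tangencySet φ) {I : Set ℝ} (hI : IsOpen I)
    (hI' : IsPreconnected I) (h : ∀ t ∈ I, φ t p ∈ c.source) {s t : ℝ} (hs : s ∈ I) (ht : t ∈ I) :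
    (c (φ s p)).1 = (c (φ t p)).1 := by
  have hd := fun t ht => hφ.hasDerivAt_transverse_orbit hc (h t ht)
  refine hI.is_const_of_deriv_eq_zero (f := fun t => (c (φ t p)).1) hI'
    (fun t ht => (hd t ht).differentiableAt.differentiableWithinAt) (fun t ht => ?_) hs ht
  rw [(hd t ht).deriv]
  exact hφ.flow_mem_tangencySet hp t c hc (h t ht)

/-- The height is locally constant along the orbit, which is therefore a continuous curve in the
leaf topology. -/
theorem flow_mem_leaf [SecondCountableTopology M] (hφ : F.IsFoliatedFlow φ)
    {p : M} (hp : p ∈ F.tangencySet φ) (t : ℝ) : φ t p ∈ F.leaf p := by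
  have hcontM := continuous_orbit φ p
  have hcont : @Continuous ℝ M _ F.leafTopology fun t => φ t p := by
    rw [@continuous_iff_continuousAt _ _ _ F.leafTopology]
    intro s
    obtain ⟨c, hc, hpc⟩ := F.cover (φ s p)
    refine F.tendsto_nhds_leafTopology (hcontM.tendsto s) hc hpc ?_
    obtain ⟨ε, hε, hball⟩ := Metric.mem_nhds_iff.1
      (hcontM.continuousAt (c.open_source.mem_nhds hpc))
    filter_upwards [Metric.ball_mem_nhds s hε] with r hr
    exact hφ.transverse_orbit_eq hc hp Metric.isOpen_ball (convex_ball s ε).isPreconnected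
      hball hr (Metric.mem_ball_self hε)
  have hj := @IsPathConnected.joinedIn M F.leafTopology _
    (@IsPathConnected.image _ M _ F.leafTopology _ isPathConnected_univ _ hcont)
    p ⟨0, trivial, φ.map_zero_apply p⟩ (φ t p) ⟨t, trivial, rfl⟩
  exact @JoinedIn.joined M F.leafTopology _ _ _ hj

theorem leaf_mem_preservedLeaves [SecondCountableTopology M] (hφ : F.IsFoliatedFlow φ)
    {p : M} (hp : p ∈ F.tangencySet φ) : F.leaf p ∈ F.preservedLeaves φ := by
  have hsub : ∀ t, MapsTo (φ t) (F.leaf p) (F.leaf p) := fun t => by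
    have := hφ.mapsTo t p
    rwa [F.leaf_eq_of_mem (hφ.flow_mem_leaf hp t)] at this
  refine ⟨⟨p, rfl⟩, fun t => (hsub t).image_subset.antisymm fun q hq => ?_⟩
  refine ⟨φ (-t) q, hsub (-t) hq, ?_⟩
  rw [← φ.map_add, add_neg_cancel, φ.map_zero_apply]

end IsFoliatedFlow

/-! ### Consequences of transverse simplicity -/

namespace IsTransverselySimpleFlow

variable {F : Foliation m M} {φ : Flow ℝ M} {c : OpenPartialHomeomorph M (FoliatedModel m)}

theorem preservedSet_eq [SecondCountableTopology M] (hφ : F.IsTransverselySimpleFlow φ) :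
    F.preservedSet φ = F.tangencySet φ := by
  refine Subset.antisymm ?_ fun p hp =>
    ⟨_, hφ.toIsFoliatedFlow.leaf_mem_preservedLeaves hp, F.mem_leaf_self p⟩
  rintro p ⟨L, hL, hpL⟩ c hc hpc
  have h := (hφ.simple L hL p hpL c hc hpc).1
  have e : c.symm ((c p).1, (c p).2) = p := c.left_inv hpc
  simp only [inducedFlow, e] at h
  exact ((hasDerivAt_const (0 : ℝ) (c p).1).congr_of_eventuallyEq h).deriv

/-- Near each of its points, the tangency set is contained in a plaque. -/
theorem eventually_transverse_eq [SecondCountableTopology M] (hφ : F.IsTransverselySimpleFlow φ)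
    (hc : c ∈ F.charts) {p : M} (hpc : p ∈ c.source) (hp : p ∈ F.tangencySet φ) :
    ∀ᶠ q in 𝓝 p, q ∈ F.tangencySet φ → (c q).1 = (c p).1 := by
  have hφ' := hφ.toIsFoliatedFlow
  obtain ⟨-, κ, hκ, hder⟩ := hφ.simple _ (hφ'.leaf_mem_preservedLeaves hp) p (F.mem_leaf_self p)
    c hc hpc
  obtain ⟨W, hW, V, hV, hVc, hWV⟩ := hφ'.exists_nhds_transverse_eq hc hc (t₀ := 0) hpc
    (by rwa [φ.map_zero_apply])
  obtain ⟨ε, hε, hball⟩ := Metric.mem_nhds_iff.1 (inter_mem hder hW)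
  -- Any nonzero time in the ball would do; one such time already isolates the fixed point.
  have htε : ε / 2 ∈ Metric.ball (0 : ℝ) ε := by
    rw [Metric.mem_ball, dist_zero_right, Real.norm_of_nonneg (by positivity)]; linarith
  set t := ε / 2
  have hne : Real.exp (κ * t) - 1 ≠ 0 := by
    rw [sub_ne_zero, Ne, Real.exp_eq_one_iff]
    exact mul_ne_zero hκ (by positivity)
  have hd : HasDerivAt (fun u => inducedFlow φ c p t u - u) (Real.exp (κ * t) - 1) (c p).1 :=
    HasDerivAt.sub (hball htε).1 (hasDerivAt_id _)
  have hfix := hd.eventually_ne hne (c := 0)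
  rw [eventually_nhdsWithin_iff] at hfix
  have hfst : Tendsto (fun q => (c q).1) (𝓝 p) (𝓝 (c p).1) :=
    (continuousAt_fst.comp (c.continuousAt hpc)).tendsto
  filter_upwards [hfst.eventually hfix, hV, tendsto_project_transversal hpc hV,
    eventually_project_transversal hpc] with q hq hqV hqV' hproj hqZ
  by_contra hcon
  refine hq hcon ?_
  have h1 : (c (φ t q)).1 = inducedFlow φ c p t (c q).1 :=
    (hWV t (hball htε).2 q hqV).2 _ hqV' (by rw [hproj])
  have h2 : (c (φ t q)).1 = (c (φ 0 q)).1 :=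
    hφ'.transverse_orbit_eq hc hqZ Metric.isOpen_ball (convex_ball 0 ε).isPreconnected
      (fun s hs => (hWV s (hball hs).2 q hqV).1) htε (Metric.mem_ball_self hε)
  rw [← h1, h2, φ.map_zero_apply, sub_self]

/-- Since the set lies locally in one plaque, the identity on it is continuous from the manifold
topology to the leaf topology. -/
theorem isLeafwiseCompact_tangencySet [SecondCountableTopology M] [CompactSpace M]
    (hφ : F.IsTransverselySimpleFlow φ) : F.IsLeafwiseCompact (F.tangencySet φ) := by
  have hcont : @ContinuousOn M M _ F.leafTopology id (F.tangencySet φ) := by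
    intro p hp
    obtain ⟨c, hc, hpc⟩ := F.cover p
    refine F.tendsto_nhds_leafTopology (tendsto_id.mono_left inf_le_left) hc hpc ?_
    filter_upwards [self_mem_nhdsWithin,
      mem_nhdsWithin_of_mem_nhds (hφ.eventually_transverse_eq hc hpc hp)] with q hq h
    exact h hq
  have := @IsCompact.image_of_continuousOn M M _ F.leafTopology _ _
    hφ.toIsFoliatedFlow.isClosed_tangencySet.isCompact hcont
  rwa [image_id] at this

theorem leaf_subset_tangencySet [SecondCountableTopology M]
    (hφ : F.IsTransverselySimpleFlow φ) {p : M} (hp : p ∈ F.tangencySet φ) :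
    F.leaf p ⊆ F.tangencySet φ := by
  rw [← hφ.preservedSet_eq]
  exact subset_sUnion_of_mem (hφ.toIsFoliatedFlow.leaf_mem_preservedLeaves hp)

theorem isLeafwiseCompact_leaf [SecondCountableTopology M] [CompactSpace M]
    (hφ : F.IsTransverselySimpleFlow φ) {p : M} (hp : p ∈ F.tangencySet φ) :
    F.IsLeafwiseCompact (F.leaf p) :=
  @IsCompact.of_isClosed_subset M F.leafTopology _ _ hφ.isLeafwiseCompact_tangencySet
    (F.isClosed_leafTopology_leaf p) (hφ.leaf_subset_tangencySet hp)

theorem finite_leaves_tangencySet [SecondCountableTopology M] [CompactSpace M]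
    (hφ : F.IsTransverselySimpleFlow φ) : (F.leaf '' F.tangencySet φ).Finite := by
  obtain ⟨s, hs, hcov⟩ := @IsCompact.elim_nhds_subcover M F.leafTopology _
    hφ.isLeafwiseCompact_tangencySet F.leaf fun p _ =>
      @IsOpen.mem_nhds M F.leafTopology _ _ (F.isOpen_leafTopology_leaf p) (F.mem_leaf_self p)
  refine (s.finite_toSet.image F.leaf).subset ?_
  rintro _ ⟨p, hp, rfl⟩
  obtain ⟨q, hq, hpq⟩ := mem_iUnion₂.1 (hcov hp)
  exact ⟨q, hq, (F.leaf_eq_of_mem hpq).symm⟩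

end IsTransverselySimpleFlow

end Foliation

namespace Foliation

open Set Filter

variable {m : ℕ} {M : Type*} [TopologicalSpace M]
  [ChartedSpace (EuclideanSpace ℝ (Fin (m + 1))) M]

/-! ### Holonomy of leaves transverse to the flow -/

namespace IsFoliatedFlow

variable {F : Foliation m M} {φ : Flow ℝ M} {c c' : OpenPartialHomeomorph M (FoliatedModel m)}

/-- The germ at t = 0 of the height of φ^t(γ s) is locally constant in s. Working with germs avoids
choosing a time interval uniform in s. -/
theorem eventually_transverse_flow_eq [SecondCountableTopology M] (hφ : F.IsFoliatedFlow φ)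
    (hc : c ∈ F.charts) {γ : unitInterval → M}
    (hγ : Continuous[instTopologicalSpaceSubtype, F.leafTopology] γ) {a b : unitInterval}
    (hab : a ≤ b) (hsrc : ∀ s ∈ Icc a b, γ s ∈ c.source) :
    ∀ᶠ t in 𝓝 (0 : ℝ), (c (φ t (γ b))).1 = (c (φ t (γ a))).1 := by
  have hγM : Continuous γ := continuous_le_rng F.leafTopology_le hγ
  let E : unitInterval → Germ (𝓝 (0 : ℝ)) ℝ := fun s => ((fun t => (c (φ t (γ s))).1 : ℝ → ℝ) : _)
  -- With the discrete topology, local constancy becomes continuity.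
  let _ : TopologicalSpace (Germ (𝓝 (0 : ℝ)) ℝ) := ⊥
  have _ : DiscreteTopology (Germ (𝓝 (0 : ℝ)) ℝ) := ⟨rfl⟩
  have hE : ContinuousOn E (Icc a b) := by
    intro s hs
    obtain ⟨W, hW, V, hV, -, hWV⟩ := hφ.exists_nhds_transverse_eq hc hc (t₀ := 0) (hsrc s hs)
      (by rw [φ.map_zero_apply]; exact hsrc s hs)
    have hev : ∀ᶠ r in 𝓝 s, E r = E s := by
      have hpl : ∀ᶠ r in 𝓝 s, γ r ∈ plaque c (c (γ s)).1 :=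
        (@Continuous.tendsto _ _ _ F.leafTopology _ hγ s)
          (F.plaque_mem_nhds_leafTopology hc (hsrc s hs))
      filter_upwards [hpl, hγM.continuousAt hV] with r hr hrV
      refine Germ.coe_eq.2 ?_
      filter_upwards [hW] with t ht
      exact (hWV t ht _ hrV).2 _ (mem_of_mem_nhds hV) hr.2
    exact (continuousAt_const.congr (EventuallyEq.symm hev)).continuousWithinAt
  exact Germ.coe_eq.1 (isPreconnected_Icc.constant hE (right_mem_Icc.2 hab) (left_mem_Icc.2 hab))

/-- Holonomy transformations commute with the flow. -/
theorem eventually_holonomy_eq [SecondCountableTopology M] (hφ : F.IsFoliatedFlow φ)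
    {γ : unitInterval → M} (hγ : Continuous[instTopologicalSpaceSubtype, F.leafTopology] γ)
    {a b : unitInterval} {h : ℝ → ℝ} (hol : F.IsHolonomyAlong γ a b c c' h) :
    ∀ᶠ t in 𝓝 (0 : ℝ), (c' (φ t (γ b))).1 = h (c (φ t (γ a))).1 := by
  induction hol with
  | single hc hab hsrc => exact hφ.eventually_transverse_flow_eq hc hγ hab hsrc
  | @step b d c c' c'' h g hol hc hbd hsrc hg ih =>
    filter_upwards [ih, (tendsto_orbit_zero φ (γ b)).eventually hg,
      hφ.eventually_transverse_flow_eq hc hγ hbd hsrc] with t h1 h2 h3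
    rw [h3, h2, h1, Function.comp]

theorem hasNoHolonomy_of_not_tangent [SecondCountableTopology M] (hφ : F.IsFoliatedFlow φ)
    {L : Set M} (hL : ∀ p ∈ L, p ∉ F.tangencySet φ) : F.HasNoHolonomy L := by
  intro p hp c hc hpc
  refine Subset.antisymm ?_ ?_
  · rintro _ ⟨γ, h, hγ, h0, h1, hol, rfl⟩
    have hne : transverseSpeed φ c p ≠ 0 := fun h => hL p hp ((hφ.mem_tangencySet hc hpc).2 h)
    have hp0 : φ 0 p ∈ c.source := by rwa [φ.map_zero_apply]
    have hd := hφ.hasDerivAt_transverse_orbit hc hp0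
    have hs := (hφ.contDiffAt_transverse_orbit hc hp0).fst.hasStrictDerivAt' hd (by simp)
    rw [φ.map_zero_apply] at hs
    -- Inverse function theorem: the heights of φ^t(p), for t near 0, fill a neighborhood of the
    -- height of p.
    have hmap := hs.map_nhds_eq hne
    rw [φ.map_zero_apply] at hmap
    have hev := hφ.eventually_holonomy_eq hγ hol
    rw [h0, h1] at hev
    refine Germ.coe_eq.2 ?_
    rw [EventuallyEq, ← hmap, eventually_map]
    filter_upwards [hev] with t ht using ht.symm
  · rintro _ rfl
    exact ⟨fun _ => p, id, @continuous_const _ _ _ F.leafTopology p, rfl, rfl,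
      .single hc zero_le_one fun _ _ => hpc, rfl⟩

end IsFoliatedFlow

end Foliation

theorem propositionp {m : ℕ} {M : Type*} [TopologicalSpace M] [T2Space M] [CompactSpace M]
    [ChartedSpace (EuclideanSpace ℝ (Fin (m + 1))) M] [IsManifold (𝓡 (m + 1)) ∞ M]
    (F : Foliation m M) (φ : Flow ℝ M) (hφ : F.IsTransverselySimpleFlow φ) :
    (∃ S : Set (Set M), S.Finite ∧ (∀ L ∈ S, L ∈ F.leaves ∧ F.IsLeafwiseCompact L) ∧
      F.preservedSet φ = ⋃₀ S) ∧
    F.IsAlmostWithoutHolonomy ∧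
    {L | L ∈ F.leaves ∧ ¬ F.HasNoHolonomy L}.Finite := by
  have : SecondCountableTopology M :=
    ChartedSpace.secondCountable_of_sigmaCompact (EuclideanSpace ℝ (Fin (m + 1))) M
  -- A leaf with holonomy must meet the tangency set, so it is one of finitely many compact leaves;
  -- this yields both (2) and (3).
  have hhol : ∀ L ∈ F.leaves, ¬ F.HasNoHolonomy L → L ∈ F.leaf '' F.tangencySet φ := by
    intro L hL hnot
    by_contra hcon
    obtain ⟨q, rfl⟩ := hL
    exact hnot (hφ.toIsFoliatedFlow.hasNoHolonomy_of_not_tangent fun p hp hpZ =>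
      hcon ⟨p, hpZ, F.leaf_eq_of_mem hp⟩)
  refine ⟨⟨F.leaf '' F.tangencySet φ, hφ.finite_leaves_tangencySet, ?_, ?_⟩, ?_, ?_⟩
  · rintro _ ⟨p, hp, rfl⟩
    exact ⟨⟨p, rfl⟩, hφ.isLeafwiseCompact_leaf hp⟩
  · rw [hφ.preservedSet_eq, Set.sUnion_image]
    refine Set.Subset.antisymm (fun p hp => Set.mem_iUnion₂.2 ⟨p, hp, F.mem_leaf_self p⟩) ?_
    exact Set.iUnion₂_subset fun p hp => hφ.leaf_subset_tangencySet hp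
  · intro L hL hnc
    by_contra hnot
    obtain ⟨p, hp, rfl⟩ := hhol L hL hnot
    exact hnc (hφ.isLeafwiseCompact_leaf hp)
  · exact hφ.finite_leaves_tangencySet.subset fun L hL => hhol L hL.1 hL.2
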